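/- Let $A,B$ be finite-dimensional quantum systems, $d=\dim A\ge 1$. A channel is a completely positive trace-preserving linear map from operators on $A$ to operators on $B$; it is entanglement-breaking (EB) if it has the measure-and-prepare form $\rho\mapsto\sum_i \mathrm{Tr}[\rho P_i]\,\sigma_i$ for a finite POVM $\{P_i\}$ on $A$ and states $\sigma_i$ on $B$. For a channel $\mathcal N$ let $$R(\mathcal N)=\min\Big\{s\ge 0:\exists\,\mathcal M\in\mathrm{EB},\ \tfrac{1}{s+1}\mathcal N+\tfrac{s}{s+1}\mathcal M\in\mathrm{EB}\Big\},\qquad R_G(\mathcal N)=\min\Big\{s\ge 0:\exists\,\text{a channel }\mathcal M,\ \tfrac{1}{s+1}\mathcal N+\tfrac{s}{s+1}\mathcal M\in\mathrm{EB}\Big\}.$$ A game $\mathcal G=(\{\alpha_{ij}\},\{\sigma_i\},\{O_j\})$ consists of finitely many input states $\sigma_i$ on $A$, a POVM $\{O_j\}$ on $B$ with finitely many outcomes, and real coefficients $\alpha_{ij}$; its payoff is $\mathcal P(\mathcal N,\mathcal G)=\sum_{i,j}\alpha_{ij}\mathrm{Tr}[\mathcal N(\sigma_i)O_j]$. Theorem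 3. Let $\mathcal N$ be a channel from $A$ to $B$. The minima $R(\mathcal N)$ and $R_G(\mathcal N)$ exist, every game $\mathcal G$ has a best EB payoff $\max_{\mathcal M\in\mathrm{EB}}\mathcal P(\mathcal M,\mathcal G)$, and: 1. $$\max_{\mathcal G}\frac{\mathcal P(\mathcal N,\mathcal G)}{\max_{\mathcal M\in\mathrm{EB}}\mathcal P(\mathcal M,\mathcal G)}=1+R(\mathcal N),$$ where the maximum is attained and runs over all games with $\mathcal P(\mathcal M,\mathcal G)\ge 0$ for every $\mathcal M\in\mathrm{EB}$ whose best EB payoff is positive. (If $\mathcal P(\mathcal M,\mathcal G)\ge 0$ on EB and the best EB payoff is $0$, then $\mathcal P(\mathcal N,\mathcal G)=0$ too, so that the ratio is $0/0$.) 2. $$\max_{\mathcal G}\mathcal P(\mathcal N,\mathcal G)=1+R_G(\mathcal N),$$ where the maximum is attained and runs over all games with $\mathcal P(\mathcal M,\mathcal G)\ge 0$ for every channel $\mathcal M$ and $\mathcal P(\mathcal M,\mathcal G)\le 1$ for every $\mathcal M\in\mathrm{EB}$. 3. Let $\Phi_{\mathcal M}=(\mathrm{id}\otimes\mathcal M)\big(\tfrac1d\sum_{k,l}|kk\rangle\langle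 ll|\big)$ be the Choi state of $\mathcal M$ and $W_{\mathcal G}=d\sum_{i,j}\alpha_{ij}\,\sigma_i^T\otimes O_j$. For every game $\mathcal G$, $W_{\mathcal G}$ is Hermitian and $\mathcal P(\mathcal M,\mathcal G)=\mathrm{Tr}[\Phi_{\mathcal M}W_{\mathcal G}]$ for every channel $\mathcal M$; and every Hermitian operator $W$ on $A\otimes B$ equals $W_{\mathcal G}$ for some game $\mathcal G$. -/

import Mathlib

open scoped Matrix Kronecker ComplexOrder

noncomputable section

namespace QMemory

/-- A density matrix: positive semidefinite with unit trace. -/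
def IsState {A : Type*} [Fintype A] (ρ : Matrix A A ℂ) : Prop :=
  ρ.PosSemidef ∧ ρ.trace = 1

/-- A positive operator valued measure with finitely many outcomes. -/
def IsPOVM {A ι : Type*} [Fintype A] [DecidableEq A] [Fintype ι]
    (P : ι → Matrix A A ℂ) : Prop :=
  (∀ i, (P i).PosSemidef) ∧ ∑ i, P i = 1

/-- The map `id_R ⊗ N`, acting on an operator on `R ⊗ A` by applying `N` to each of its
`A`-blocks. -/
def ampliation {A B : Type*} (R : Type*) (N : Matrix A A ℂ →ₗ[ℂ] Matrix B B ℂ)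
    (X : Matrix (R × A) (R × A) ℂ) : Matrix (R × B) (R × B) ℂ :=
  Matrix.of fun p q => N (Matrix.of fun a a' => X (p.1, a) (q.1, a')) p.2 q.2

/-- Complete positivity: `id_k ⊗ N` preserves positive semidefiniteness for every `k`. -/
def IsCompletelyPositive {A B : Type*} (N : Matrix A A ℂ →ₗ[ℂ] Matrix B B ℂ) : Prop :=
  ∀ (k : ℕ) (X : Matrix (Fin k × A) (Fin k × A) ℂ),
    X.PosSemidef → (ampliation (Fin k) N X).PosSemidef

/-- A quantum channel (quantum memory): a completely positive trace-preserving linear map. -/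
def IsChannel {A B : Type*} [Fintype A] [Fintype B]
    (N : Matrix A A ℂ →ₗ[ℂ] Matrix B B ℂ) : Prop :=
  IsCompletelyPositive N ∧ ∀ X, (N X).trace = X.trace

/-- Entanglement-breaking (measure-and-prepare) channels:
`ρ ↦ ∑ i, Tr[ρ Pᵢ] σᵢ` for a POVM `P` and states `σᵢ`. -/
def IsEB {A B : Type*} [Fintype A] [DecidableEq A] [Fintype B]
    (N : Matrix A A ℂ →ₗ[ℂ] Matrix B B ℂ) : Prop :=
  ∃ (n : ℕ) (P : Fin n → Matrix A A ℂ) (σ : Fin n → Matrix B B ℂ),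
    IsPOVM P ∧ (∀ i, IsState (σ i)) ∧ ∀ ρ, N ρ = ∑ i, (ρ * P i).trace • σ i

/-- The noise levels `s ≥ 0` at which mixing `N` with some EB channel gives an EB channel. -/
def robustnessSet {A B : Type*} [Fintype A] [DecidableEq A] [Fintype B]
    (N : Matrix A A ℂ →ₗ[ℂ] Matrix B B ℂ) : Set ℝ :=
  {s | 0 ≤ s ∧ ∃ M : Matrix A A ℂ →ₗ[ℂ] Matrix B B ℂ,
    IsEB M ∧ IsEB ((1 / (s + 1)) • N + (s / (s + 1)) • M)}

/-- The robustness `R(N)` of a quantum memory. -/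
def robustness {A B : Type*} [Fintype A] [DecidableEq A] [Fintype B]
    (N : Matrix A A ℂ →ₗ[ℂ] Matrix B B ℂ) : ℝ :=
  sInf (robustnessSet N)

/-- The noise levels `s ≥ 0` at which mixing `N` with some channel gives an EB channel. -/
def genRobustnessSet {A B : Type*} [Fintype A] [DecidableEq A] [Fintype B]
    (N : Matrix A A ℂ →ₗ[ℂ] Matrix B B ℂ) : Set ℝ :=
  {s | 0 ≤ s ∧ ∃ M : Matrix A A ℂ →ₗ[ℂ] Matrix B B ℂ,
    IsChannel M ∧ IsEB ((1 / (s + 1)) • N + (s / (s + 1)) • M)}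

/-- The generalised robustness `R_G(N)` of a quantum memory. -/
def genRobustness {A B : Type*} [Fintype A] [DecidableEq A] [Fintype B]
    (N : Matrix A A ℂ →ₗ[ℂ] Matrix B B ℂ) : ℝ :=
  sInf (genRobustnessSet N)

/-- A game: finitely many input states, a measurement on the output, and real coefficients. -/
structure Game (A B : Type*) [Fintype A] [Fintype B] [DecidableEq B] where
  /-- the number of input states -/
  nIn : ℕ
  /-- the number of measurement outcomes -/
  nOut : ℕ
  /-- the coefficients -/
  α : Fin nIn → Fin nOut → ℝ
  /-- the input states -/
  σ : Fin nIn → Matrix A A ℂ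
  /-- the measurement on the output system -/
  O : Fin nOut → Matrix B B ℂ
  isState : ∀ i, IsState (σ i)
  isPOVM : IsPOVM O

/-- The payoff `∑ i j, αᵢⱼ Tr[N(σᵢ) Oⱼ]`; the traces are real when `N` is a channel. -/
def payoff {A B : Type*} [Fintype A] [Fintype B] [DecidableEq B]
    (N : Matrix A A ℂ →ₗ[ℂ] Matrix B B ℂ) (G : Game A B) : ℝ :=
  ∑ i, ∑ j, G.α i j * ((N (G.σ i) * G.O j).trace).re

/-- The payoffs of a game that EB channels achieve. -/
def ebPayoffs {A B : Type*} [Fintype A] [DecidableEq A] [Fintype B] [DecidableEq B]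
    (G : Game A B) : Set ℝ :=
  {p | ∃ M : Matrix A A ℂ →ₗ[ℂ] Matrix B B ℂ, IsEB M ∧ p = payoff M G}

/-- The best payoff of a game over all EB channels. -/
def bestEBPayoff {A B : Type*} [Fintype A] [DecidableEq A] [Fintype B] [DecidableEq B]
    (G : Game A B) : ℝ :=
  sSup (ebPayoffs G)

/-- The maximally entangled state `(1/d) ∑ |aa⟩⟨a'a'|`. -/
def maxEntangled (A : Type*) [Fintype A] [DecidableEq A] : Matrix (A × A) (A × A) ℂ :=
  Matrix.of fun p q =>
    if p.1 = p.2 ∧ q.1 = q.2 then (1 / (Fintype.card A : ℂ)) else 0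

/-- The normalised Choi state of a channel. -/
def choi {A B : Type*} [Fintype A] [DecidableEq A]
    (N : Matrix A A ℂ →ₗ[ℂ] Matrix B B ℂ) : Matrix (A × B) (A × B) ℂ :=
  ampliation A N (maxEntangled A)

/-- The Hermitian operator `d ∑ i j, αᵢⱼ σᵢᵀ ⊗ Oⱼ` of a game. -/
def Game.witness {A B : Type*} [Fintype A] [Fintype B] [DecidableEq B]
    (G : Game A B) : Matrix (A × B) (A × B) ℂ :=
  (Fintype.card A : ℂ) • ∑ i, ∑ j, (G.α i j : ℂ) • ((G.σ i)ᵀ ⊗ₖ G.O j)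

end QMemory

end

/-! Everything is moved to Choi matrices. Channels correspond to states whose `A`-marginal is
maximally mixed (`isChannel_iff`), EB channels to the separable ones among them (`isEB_iff`), a
compact convex set `K`. If `x` is the Choi state of `N`, noise level `s` is feasible iff `(1 + s) •
e - x` lies in a closed convex cone `C` for some `e ∈ K`; the cone is generated by the separable
states for `R`, by all states for `R_G`. Both robustnesses are thus values of one conic program.

The upper bounds are weak duality: payoffs are affine in the channel, so a feasible mixture
expresses the payoff of `N` through those of an EB channel and of the noise (`payoff_mixture`).

Attainment is strong duality (`exists_dual_of_cone`): Hahn–Banach gives a functional that is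
nonnegative on `C`, has maximum `1` on `K` and takes the value `1 + s₀` at `x`, where `s₀` is the
least feasible level. Slater's condition holds because the identity is interior to the separable
cone. On Hermitian matrices the functional is a trace pairing with a Hermitian `W`, and product
states span, so `W` is the operator of a game.

The cones constrain only the Hermitian part of a matrix. They therefore have interior in the full
matrix space, and no separate space of Hermitian matrices is needed. -/

namespace QMemory

open Set Filter Topology

/-! ### Convex analysis and conic duality -/

/-- The projection of a closed set along a compact set is closed. -/
theorem isClosed_exists_mem_of_isCompact {X Y : Type*} [TopologicalSpace X] [TopologicalSpace Y]
    {K : Set Y} (hK : IsCompact K) {S : Set (X × Y)} (hS : IsClosed S) :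
    IsClosed {x | ∃ y ∈ K, (x, y) ∈ S} := by
  have := isCompact_iff_compactSpace.1 hK
  have hT : IsClosed {p : X × K | (p.1, (p.2 : Y)) ∈ S} := hS.preimage (by fun_prop)
  convert isClosedMap_fst_of_compactSpace _ hT using 1
  ext x
  simp

/-- Carathéodory: in finite dimension the convex hull of a compact set is compact. -/
theorem isCompact_convexHull_of_isCompact {V : Type*} [AddCommGroup V] [Module ℝ V]
    [TopologicalSpace V] [IsTopologicalAddGroup V] [ContinuousSMul ℝ V] [FiniteDimensional ℝ V]
    {s : Set V} (hs : IsCompact s) : IsCompact (convexHull ℝ s) := by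
  rcases s.eq_empty_or_nonempty with rfl | ⟨s₀, hs₀⟩
  · simp
  let m := Module.finrank ℝ V + 1
  have hc : IsCompact (stdSimplex ℝ (Fin m) ×ˢ Set.pi univ fun _ : Fin m => s) :=
    (isCompact_stdSimplex ℝ (Fin m)).prod (isCompact_univ_pi fun _ => hs)
  have hf : Continuous fun p : (Fin m → ℝ) × (Fin m → V) => ∑ i, p.1 i • p.2 i := by fun_prop
  convert hc.image hf using 1
  ext x
  constructor
  · intro hx
    obtain ⟨ι, _, z, w, hz, hind, hw, hw1, rfl⟩ := eq_pos_convex_span_of_mem_convexHull hx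
    -- Affine independence bounds the number of points by `m`. Unused slots get weight `0` and the
    -- filler point `s₀`, which keeps the tuple in the compact product.
    obtain ⟨e⟩ : Nonempty (ι ↪ Fin m) := by
      rw [Function.Embedding.nonempty_iff_card_le, Fintype.card_fin]
      exact hind.card_le_finrank_succ.trans (Nat.succ_le_succ (Submodule.finrank_le _))
    have hext : ∀ i ∉ Set.range e, Function.extend e w 0 i = 0 := fun i hi =>
      Function.extend_apply' _ _ _ (by simpa using hi)
    refine ⟨(Function.extend e w 0, Function.extend e z fun _ => s₀), ⟨⟨fun i => ?_, ?_⟩, ?_⟩, ?_⟩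
    · by_cases hi : i ∈ Set.range e
      · obtain ⟨j, rfl⟩ := hi
        simpa [e.injective.extend_apply] using (hw j).le
      · exact (hext i hi).ge
    · rw [← hw1]
      exact (Fintype.sum_of_injective e e.injective _ _ hext
        fun i => (e.injective.extend_apply _ _ _).symm).symm
    · intro i _
      by_cases hi : i ∈ Set.range e
      · obtain ⟨j, rfl⟩ := hi
        simpa [e.injective.extend_apply] using hz ⟨j, rfl⟩
      · simpa [Function.extend_apply' _ _ _ (by simpa using hi : ¬∃ a, e a = i)] using hs₀
    · refine (Fintype.sum_of_injective e e.injective _ _ (fun i hi => ?_) fun i => ?_).symm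
      · simp [hext i hi]
      · simp [e.injective.extend_apply]
  · rintro ⟨⟨w, z⟩, ⟨⟨hw, hw1⟩, hz⟩, rfl⟩
    exact (convex_convexHull ℝ s).sum_mem (fun i _ => hw i) hw1
      fun i _ => subset_convexHull ℝ s (hz i trivial)

/-- In finite dimension an order unit of a convex cone is an interior point. -/
theorem mem_interior_of_forall_exists_add_mem {V : Type*} [AddCommGroup V] [Module ℝ V]
    [TopologicalSpace V] [IsTopologicalAddGroup V] [ContinuousSMul ℝ V] [T2Space V]
    [FiniteDimensional ℝ V] {C : Set V} (hC : Convex ℝ C)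
    (hs : ∀ t : ℝ, 0 ≤ t → ∀ c ∈ C, t • c ∈ C) {u : V} (huC : u ∈ C)
    (hu : ∀ v, ∃ t : ℝ, 0 ≤ t ∧ t • u + v ∈ C) : u ∈ interior C := by
  have hadd : ∀ x ∈ C, ∀ y ∈ C, x + y ∈ C := fun x hx y hy => by
    have := hs 2 (by norm_num) _ (hC hx hy (a := 1 / 2) (b := 1 / 2)
      (by norm_num) (by norm_num) (by norm_num))
    simpa [smul_add, smul_smul] using this
  let b := Module.finBasis ℝ V
  choose t ht0 ht using hu
  -- Adding the constants for `b i` and `-b i` gives one that serves both signs.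
  let T : Fin _ → ℝ := fun i => t (b i) + t (-b i)
  have hT : ∀ i (c : ℝ), (|c| * T i) • u + c • b i ∈ C := fun i c => by
    have hp : (|c|) • (T i • u + b i) ∈ C := hs _ (abs_nonneg c) _ (by
      have := hadd _ (ht (b i)) _ (hs _ (ht0 (-b i)) _ huC)
      convert this using 1
      simp only [T]; module)
    have hm : (|c|) • (T i • u - b i) ∈ C := hs _ (abs_nonneg c) _ (by
      have := hadd _ (ht (-b i)) _ (hs _ (ht0 (b i)) _ huC)
      convert this using 1
      simp only [T]; module)
    rcases abs_cases c with ⟨h, _⟩ | ⟨h, _⟩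
    · rw [h] at hp ⊢
      convert hp using 1
      module
    · rw [h] at hm ⊢
      convert hm using 1
      module
  have h0 : (0 : V) ∈ C := by simpa using hs 0 le_rfl u huC
  have hsum : ∀ v : V, (∑ i, |b.repr v i| * T i) • u + v ∈ C := fun v => by
    have : ∑ i, ((|b.repr v i| * T i) • u + b.repr v i • b i) ∈ C :=
      Finset.sum_induction _ (· ∈ C) (fun x y hx hy => hadd x hx y hy) h0 fun i _ => hT i _
    rwa [Finset.sum_add_distrib, b.sum_repr, ← Finset.sum_smul] at this
  have hcont : Continuous fun v : V => ∑ i, |b.repr (v - u) i| * T i := by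
    refine continuous_finsetSum _ fun i _ => ?_
    have : Continuous (b.coord i) := LinearMap.continuous_of_finiteDimensional _
    have h2 : Continuous fun v => b.coord i (v - u) := this.comp (by fun_prop)
    exact (h2.abs).mul continuous_const
  -- Near `u` the multiple of `u` needed to absorb `v - u` is below `1`, so a single `u` suffices.
  refine mem_interior.2 ⟨{v | ∑ i, |b.repr (v - u) i| * T i < 1}, fun v hv => ?_,
    isOpen_lt hcont continuous_const, by simp⟩
  have := hadd _ (hsum (v - u)) _ (hs (1 - ∑ i, |b.repr (v - u) i| * T i)
    (sub_nonneg.2 (le_of_lt hv)) _ huC)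
  convert this using 1
  module

/-- Strong duality for the robustness of `x` with respect to a compact convex set `K`, with
noise in the closed convex cone `C`. -/
theorem exists_dual_of_cone {V : Type*} [AddCommGroup V] [Module ℝ V]
    [TopologicalSpace V] [IsTopologicalAddGroup V] [ContinuousSMul ℝ V]
    {K C : Set V} (hK : IsCompact K) (hKc : Convex ℝ K) (hC : IsClosed C) (hCc : Convex ℝ C)
    (hs : ∀ t : ℝ, 0 ≤ t → ∀ c ∈ C, t • c ∈ C) (τ : V →ₗ[ℝ] ℝ) (hτK : ∀ e ∈ K, τ e = 1)
    (hτC : ∀ c ∈ C, 0 ≤ τ c) {u : V} (huK : u ∈ K) (hu : u ∈ interior C) {x : V} (hx : τ x = 1)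
    {S : Set ℝ} (hS : ∀ s, s ∈ S ↔ 0 ≤ s ∧ ∃ e ∈ K, (1 + s) • e - x ∈ C) :
    IsLeast S (sInf S) ∧ ∃ f : V →L[ℝ] ℝ, (∀ c ∈ C, 0 ≤ f c) ∧ (∀ e ∈ K, f e ≤ 1) ∧
      (∃ e ∈ K, f e = 1) ∧ f x = 1 + sInf S := by
  have hadd : ∀ x ∈ C, ∀ y ∈ C, x + y ∈ C := fun x hx y hy => by
    have := hs 2 (by norm_num) _ (hCc hx hy (a := 1 / 2) (b := 1 / 2)
      (by norm_num) (by norm_num) (by norm_num))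
    simpa [smul_add, smul_smul] using this
  have huC := interior_subset hu
  have hSeq : S = Ici 0 ∩ {s | ∃ e ∈ K, (s, e) ∈ {p : ℝ × V | (1 + p.1) • p.2 - x ∈ C}} := by
    ext s
    simp [hS]
  have hScl : IsClosed S := by
    rw [hSeq]
    exact isClosed_Ici.inter (isClosed_exists_mem_of_isCompact hK (hC.preimage (by fun_prop)))
  have hSne : S.Nonempty := by
    have h1 : Tendsto (fun ε : ℝ => u - ε • x) (𝓝[>] 0) (𝓝 u) := by
      have : Continuous fun ε : ℝ => u - ε • x := by fun_prop
      simpa using (this.tendsto 0).mono_left nhdsWithin_le_nhds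
    obtain ⟨ε, hε, hε0, hε1⟩ := ((h1.eventually (mem_interior_iff_mem_nhds.1 hu)).and
      (Ioo_mem_nhdsGT (zero_lt_one' ℝ))).exists
    refine ⟨ε⁻¹ - 1, (hS _).2 ⟨sub_nonneg.2 ((one_le_inv₀ hε0).2 hε1.le), u, huK, ?_⟩⟩
    convert hs ε⁻¹ (inv_nonneg.2 hε0.le) _ hε using 1
    rw [smul_sub, smul_smul, inv_mul_cancel₀ hε0.ne', one_smul, add_sub_cancel]
  have hSbdd : BddBelow S := ⟨0, fun s h => ((hS s).1 h).1⟩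
  have hleast : IsLeast S (sInf S) := ⟨hScl.csInf_mem hSne hSbdd, fun s h => csInf_le hSbdd h⟩
  refine ⟨hleast, ?_⟩
  set s₀ := sInf S
  obtain ⟨hs₀, e₀, he₀, hc₀⟩ := (hS s₀).1 hleast.1
  set r := 1 + s₀
  have hr : 0 < r := by positivity
  -- The points strictly dominated by `r • e` for some `e ∈ K`. If `x` were one of them, the slack
  -- would allow a smaller `r`, against minimality of `s₀`.
  let D : Set V := ⋃ e ∈ K, (fun y => r • e - y) ⁻¹' interior C
  have hDo : IsOpen D := isOpen_biUnion fun e _ => isOpen_interior.preimage (by fun_prop)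
  have hDc : Convex ℝ D := by
    intro y hy z hz a b ha hb hab
    simp only [D, mem_iUnion, mem_preimage] at hy hz ⊢
    obtain ⟨e, he, hy⟩ := hy
    obtain ⟨e', he', hz⟩ := hz
    refine ⟨_, hKc he he' ha hb hab, ?_⟩
    convert hCc.interior hy hz ha hb hab using 1
    module
  have hxD : x ∉ D := by
    simp only [D, mem_iUnion, mem_preimage, not_exists]
    intro e he hmem
    have h1 : Tendsto (fun ε : ℝ => r • e - x - ε • x) (𝓝[>] 0) (𝓝 (r • e - x)) := by
      have : Continuous fun ε : ℝ => r • e - x - ε • x := by fun_prop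
      simpa using (this.tendsto 0).mono_left nhdsWithin_le_nhds
    obtain ⟨ε, hε, hε0⟩ := ((h1.eventually (mem_interior_iff_mem_nhds.1 hmem)).and
      self_mem_nhdsWithin).exists
    have hε0 : 0 < ε := hε0
    have h2 : (r / (1 + ε)) • e - x ∈ C := by
      convert hs (1 + ε)⁻¹ (by positivity) _ hε using 1
      have : x + ε • x = (1 + ε) • x := by module
      rw [sub_sub, this, smul_sub, smul_smul, smul_smul, inv_mul_cancel₀ (by positivity), one_smul,
        div_eq_inv_mul]
    have h3 := hτC _ h2
    rw [map_sub, map_smul, hτK e he, hx, smul_eq_mul, mul_one] at h3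
    have h4 : r / (1 + ε) - 1 ∈ S := (hS _).2 ⟨h3, e, he, by rwa [add_sub_cancel]⟩
    have h5 := hleast.2 h4
    have h6 : r / (1 + ε) < r := div_lt_self hr (by linarith)
    linarith
  obtain ⟨f, hf⟩ := geometric_hahn_banach_open_point hDc hDo hxD
  have hf1 : ∀ e ∈ K, ∀ c ∈ interior C, r * f e - f c < f x := fun e he c hc => by
    have : r • e - c ∈ D := by
      simp only [D, mem_iUnion, mem_preimage]
      exact ⟨e, he, by simpa using hc⟩
    simpa using hf _ this
  -- Every `c ∈ C` is a limit of the interior points `c + ε • u`.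
  have hf2 : ∀ e ∈ K, ∀ c ∈ C, r * f e ≤ f x + f c := fun e he c hc => by
    have h1 : ∀ ε : ℝ, 0 < ε → c + ε • u ∈ interior C := fun ε hε => by
      have h2 : ε • u ∈ interior C := by
        have h3 : (fun v : V => ε⁻¹ • v) ⁻¹' interior C ⊆ C := fun v hv => by
          simpa [smul_smul, hε.ne'] using hs ε hε.le _ (interior_subset hv)
        refine interior_maximal h3 (isOpen_interior.preimage (by fun_prop)) ?_
        simpa [smul_smul, hε.ne'] using hu
      have h3 : (fun v : V => v - c) ⁻¹' interior C ⊆ C := fun v hv => by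
        simpa using hadd _ hc _ (interior_subset hv)
      refine interior_maximal h3 (isOpen_interior.preimage (by fun_prop)) ?_
      simpa using h2
    have h2 : Tendsto (fun ε : ℝ => f x + (f c + ε * f u)) (𝓝[>] 0) (𝓝 (f x + f c)) := by
      have : Continuous fun ε : ℝ => f x + (f c + ε * f u) := by fun_prop
      simpa using (this.tendsto 0).mono_left nhdsWithin_le_nhds
    refine ge_of_tendsto h2 ?_
    filter_upwards [self_mem_nhdsWithin] with ε hε
    have := hf1 e he _ (h1 ε hε)
    simp only [map_add, map_smul, smul_eq_mul] at this
    linarith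
  -- A negative value could be scaled to `-∞` along the ray of `c`, against the lower bound in
  -- `hf2`.
  have hf0 : ∀ c ∈ C, 0 ≤ f c := fun c hc => by
    by_contra! hneg
    have h1 := fun t ht => hf2 u huK _ (hs t ht c hc)
    simp only [map_smul, smul_eq_mul] at h1
    have h2 := h1 ((|f x - r * f u| + 1) / (-f c)) (by
      have := neg_pos.2 hneg
      positivity)
    have h3 : (|f x - r * f u| + 1) / (-f c) * f c = -(|f x - r * f u| + 1) := by
      rw [div_neg, neg_mul, div_mul_cancel₀ _ hneg.ne]
    linarith [le_abs_self (f x - r * f u)]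
  have h0C : (0 : V) ∈ C := by simpa using hs 0 le_rfl u huC
  have hfK : ∀ e ∈ K, r * f e ≤ f x := fun e he => by simpa using hf2 e he 0 h0C
  -- Complementary slackness at the optimal `e₀`.
  have hfx : f x = r * f e₀ := by
    refine le_antisymm ?_ (hfK e₀ he₀)
    simpa using hf0 _ hc₀
  -- If `f` vanished at the interior point `u` of `C`, it would be nonnegative everywhere, so `f x ≤
  -- 0`; the strict inequality `hf1` at `u` says `0 < f x`.
  have hfu : 0 < f u := by
    refine lt_of_le_of_ne (hf0 u huC) fun h => ?_
    have hz : ∀ v, 0 ≤ f v := fun v => by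
      have h1 : Tendsto (fun ε : ℝ => u + ε • v) (𝓝[>] 0) (𝓝 u) := by
        have : Continuous fun ε : ℝ => u + ε • v := by fun_prop
        simpa using (this.tendsto 0).mono_left nhdsWithin_le_nhds
      obtain ⟨ε, hε, hε0⟩ := ((h1.eventually (mem_interior_iff_mem_nhds.1 hu)).and
        self_mem_nhdsWithin).exists
      have h2 := hf0 _ hε
      simp only [map_add, map_smul, smul_eq_mul, ← h, zero_add] at h2
      exact nonneg_of_mul_nonneg_right h2 hε0
    have h1 := hf1 u huK u hu
    have h2 := hz (-x)
    rw [map_neg] at h2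
    rw [← h] at h1
    linarith
  have hmax : ∀ e ∈ K, f e ≤ f e₀ := fun e he => by
    have := hfK e he
    rw [hfx] at this
    exact le_of_mul_le_mul_left this hr
  have hpos : 0 < f e₀ := hfu.trans_le (hmax u huK)
  refine ⟨(f e₀)⁻¹ • f, fun c hc => ?_, fun e he => ?_, ⟨e₀, he₀, ?_⟩, ?_⟩
  · exact mul_nonneg (inv_nonneg.2 hpos.le) (hf0 c hc)
  · exact (inv_mul_le_one₀ hpos).2 (hmax e he)
  · exact inv_mul_cancel₀ hpos.ne'
  · change (f e₀)⁻¹ * f x = r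
    rw [hfx]
    field_simp

end QMemory

namespace QMemory

open Set Filter Topology

/-! ### Positive semidefinite matrices and states -/

section PosSemidef

variable {n : Type*} [Fintype n]

theorem isClosed_setOf_posSemidef : IsClosed {X : Matrix n n ℂ | X.PosSemidef} := by
  have : {X : Matrix n n ℂ | X.PosSemidef} =
      {X | Xᴴ = X} ∩ ⋂ x : n → ℂ, {X | 0 ≤ star x ⬝ᵥ (X *ᵥ x)} := by
    ext X
    simp [Matrix.posSemidef_iff_dotProduct_mulVec, Matrix.IsHermitian]
  rw [this]
  refine (isClosed_eq (by fun_prop) continuous_id).inter (isClosed_iInter fun x => ?_)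
  exact isClosed_le continuous_const (by fun_prop)

/-- The entries of a positive semidefinite matrix are bounded by its trace. -/
theorem norm_apply_le_trace {X : Matrix n n ℂ} (hX : X.PosSemidef) (i j : n) :
    ‖X i j‖ ≤ X.trace.re := by
  classical
  obtain ⟨B, rfl⟩ : ∃ B, X = Bᴴ * B := by
    open scoped MatrixOrder in
    exact CStarAlgebra.nonneg_iff_eq_star_mul_self.1 hX.nonneg
  have hd : ∀ k, ((Bᴴ * B) k k).re = ∑ l, ‖B l k‖ ^ 2 := fun k => by
    simp [Matrix.mul_apply, Complex.sq_norm, Complex.normSq_apply]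
  have hk : ∀ k, ((Bᴴ * B) k k).re ≤ (Bᴴ * B).trace.re := fun k => by
    simp only [Matrix.trace, Matrix.diag, Complex.re_sum]
    exact Finset.single_le_sum (f := fun k => ((Bᴴ * B) k k).re)
      (fun i _ => by rw [hd]; positivity) (Finset.mem_univ k)
  calc ‖(Bᴴ * B) i j‖ ≤ ∑ l, ‖B l i‖ * ‖B l j‖ := by
        rw [Matrix.mul_apply]
        refine (norm_sum_le _ _).trans (Finset.sum_le_sum fun l _ => ?_)
        simp
    _ ≤ ∑ l, (‖B l i‖ ^ 2 + ‖B l j‖ ^ 2) / 2 := Finset.sum_le_sum fun l _ => by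
        nlinarith [sq_nonneg (‖B l i‖ - ‖B l j‖)]
    _ = (((Bᴴ * B) i i).re + ((Bᴴ * B) j j).re) / 2 := by
        rw [hd, hd, ← Finset.sum_add_distrib, Finset.sum_div]
    _ ≤ _ := by linarith [hk i, hk j]

theorem isCompact_setOf_isState : IsCompact {X : Matrix n n ℂ | IsState X} := by
  have hc : IsCompact (Set.pi univ fun _ : n => Set.pi univ fun _ : n =>
      Metric.closedBall (0 : ℂ) 1) :=
    isCompact_univ_pi fun _ => isCompact_univ_pi fun _ => isCompact_closedBall _ _
  refine hc.of_isClosed_subset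
    (isClosed_setOf_posSemidef.inter (isClosed_eq (f := Matrix.trace) (by fun_prop)
      continuous_const)) fun X hX i _ j _ => ?_
  have := norm_apply_le_trace hX.1 i j
  rw [hX.2] at this
  simpa using this

theorem convex_setOf_isState : Convex ℝ {X : Matrix n n ℂ | IsState X} := by
  intro X hX Y hY a b ha hb hab
  refine ⟨(hX.1.smul ha).add (hY.1.smul hb), ?_⟩
  rw [Matrix.trace_add, Matrix.trace_smul, Matrix.trace_smul, hX.2, hY.2, ← add_smul, hab,
    one_smul]

theorem IsState.transpose {X : Matrix n n ℂ} (hX : IsState X) : IsState Xᵀ :=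
  ⟨hX.1.transpose, by rw [Matrix.trace_transpose, hX.2]⟩

theorem IsState.kronecker {m : Type*} [Fintype m] {X : Matrix n n ℂ} {Y : Matrix m m ℂ}
    (hX : IsState X) (hY : IsState Y) : IsState (X ⊗ₖ Y) := by
  classical
  exact ⟨hX.1.kronecker hY.1, by rw [Matrix.trace_kronecker, hX.2, hY.2, one_mul]⟩

theorem _root_.Matrix.PosSemidef.trace_eq_ofReal_re {X : Matrix n n ℂ} (hX : X.PosSemidef) :
    X.trace = (X.trace.re : ℂ) :=
  Complex.ext rfl (by simpa using (Complex.nonneg_iff.1 hX.trace_nonneg).2.symm)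

theorem isState_smul_one [DecidableEq n] [Nonempty n] :
    IsState ((Fintype.card n : ℝ)⁻¹ • (1 : Matrix n n ℂ)) := by
  refine ⟨Matrix.PosSemidef.one.smul (by positivity), ?_⟩
  rw [Matrix.trace_smul, Matrix.trace_one, Complex.real_smul]
  simp

/-- A positive semidefinite matrix is a nonnegative multiple of a state. -/
theorem exists_isState_smul_eq [Nonempty n] {X : Matrix n n ℂ} (hX : X.PosSemidef) :
    ∃ ρ, IsState ρ ∧ X = X.trace.re • ρ := by
  classical
  have ht := hX.trace_eq_ofReal_re
  have h0 : 0 ≤ X.trace.re := (Complex.nonneg_iff.1 hX.trace_nonneg).1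
  rcases h0.eq_or_lt with h | h
  · rw [← h, Complex.ofReal_zero, hX.trace_eq_zero_iff] at ht
    exact ⟨_, isState_smul_one, by simp [ht]⟩
  · refine ⟨X.trace.re⁻¹ • X, ⟨hX.smul (by positivity), ?_⟩, ?_⟩
    · rw [Matrix.trace_smul, Complex.real_smul]
      nth_rw 2 [ht]
      rw [← Complex.ofReal_mul, inv_mul_cancel₀ h.ne', Complex.ofReal_one]
    · rw [smul_smul, mul_inv_cancel₀ h.ne', one_smul]

theorem IsState.posSemidef_one_sub [DecidableEq n] {ρ : Matrix n n ℂ} (hρ : IsState ρ) :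
    (1 - ρ).PosSemidef := by
  open scoped MatrixOrder in
  have h1 : IsSelfAdjoint ρ := hρ.1.isHermitian
  have h2 : ρ ≤ algebraMap ℝ _ 1 := by
    refine le_algebraMap_of_spectrum_le fun x hx => ?_
    rw [hρ.1.isHermitian.spectrum_real_eq_range_eigenvalues] at hx
    obtain ⟨i, rfl⟩ := hx
    have h3 := hρ.1.isHermitian.trace_eq_sum_eigenvalues
    have h4 : ∑ i, hρ.1.isHermitian.eigenvalues i = 1 := by
      simpa using congrArg Complex.re (h3.symm.trans hρ.2)
    rw [← h4]
    exact Finset.single_le_sum (fun i _ => hρ.1.eigenvalues_nonneg i) (Finset.mem_univ i)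
  rw [map_one] at h2
  exact Matrix.le_iff.1 h2

/-- States span the full matrix algebra. -/
theorem span_isState_eq_top : Submodule.span ℂ {ρ : Matrix n n ℂ | IsState ρ} = ⊤ := by
  classical
  rcases isEmpty_or_nonempty n with hn | hn
  · exact Subsingleton.elim _ _
  have hpos : ∀ X : Matrix n n ℂ, X.PosSemidef →
      X ∈ Submodule.span ℂ {ρ : Matrix n n ℂ | IsState ρ} := fun X hX => by
    obtain ⟨ρ, hρ, h⟩ := exists_isState_smul_eq hX
    rw [h, ← Complex.coe_smul]
    exact Submodule.smul_mem _ _ (Submodule.subset_span hρ)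
  have hherm : ∀ X : Matrix n n ℂ, X.IsHermitian →
      X ∈ Submodule.span ℂ {ρ : Matrix n n ℂ | IsState ρ} := fun X hX => by
    have h1 : (1 + X)ᴴ = 1 + X := by rw [Matrix.conjTranspose_add, hX.eq, Matrix.conjTranspose_one]
    have h2 : (1 - X)ᴴ = 1 - X := by rw [Matrix.conjTranspose_sub, hX.eq, Matrix.conjTranspose_one]
    -- Polarization writes a Hermitian matrix as a difference of two squares.
    have h3 : X = (1 / 4 : ℂ) • ((1 + X)ᴴ * (1 + X) - (1 - X)ᴴ * (1 - X)) := by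
      rw [h1, h2]
      have : (1 + X) * (1 + X) - (1 - X) * (1 - X) = (4 : ℂ) • X := by
        simp only [mul_add, add_mul, mul_sub, sub_mul, mul_one, one_mul]
        module
      rw [this, smul_smul]
      norm_num
    rw [h3]
    exact Submodule.smul_mem _ _ (Submodule.sub_mem _
      (hpos _ (Matrix.posSemidef_conjTranspose_mul_self _))
      (hpos _ (Matrix.posSemidef_conjTranspose_mul_self _)))
  refine eq_top_iff.2 fun X _ => ?_
  have h : X = (1 / 2 : ℂ) • (X + Xᴴ) + (-Complex.I / 2) • (Complex.I • (X - Xᴴ)) := by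
    rw [smul_smul, show -Complex.I / 2 * Complex.I = 1 / 2 by
      rw [div_mul_eq_mul_div, neg_mul, Complex.I_mul_I]; norm_num]
    module
  rw [h]
  refine Submodule.add_mem _ (Submodule.smul_mem _ _ (hherm _ ?_))
    (Submodule.smul_mem _ _ (hherm _ ?_))
  · rw [Matrix.IsHermitian, Matrix.conjTranspose_add, Matrix.conjTranspose_conjTranspose, add_comm]
  · rw [Matrix.IsHermitian, Matrix.conjTranspose_smul, Matrix.conjTranspose_sub,
      Matrix.conjTranspose_conjTranspose, Complex.star_def, Complex.conj_I, neg_smul, ← smul_neg,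
      neg_sub]

end PosSemidef

/-! ### Separable states -/

section Separable

variable {A B : Type*} [Fintype A] [Fintype B]

/-- Product states. -/
def productStates (A B : Type*) [Fintype A] [Fintype B] : Set (Matrix (A × B) (A × B) ℂ) :=
  {X | ∃ ρ σ, IsState ρ ∧ IsState σ ∧ X = ρ ⊗ₖ σ}

/-- Separable states. -/
def separableStates (A B : Type*) [Fintype A] [Fintype B] : Set (Matrix (A × B) (A × B) ℂ) :=
  convexHull ℝ (productStates A B)

/-- The Hermitian parts of the elements of this set form the cone over `T`. -/
def coneOver {n : Type*} (T : Set (Matrix n n ℂ)) : Set (Matrix n n ℂ) :=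
  {X | ∃ t : ℝ, 0 ≤ t ∧ ∃ b ∈ T, X + Xᴴ = t • b}

theorem isCompact_separableStates : IsCompact (separableStates A B) := by
  refine isCompact_convexHull_of_isCompact ?_
  have := ((isCompact_setOf_isState (n := A)).prod (isCompact_setOf_isState (n := B))).image
    (f := fun p => p.1 ⊗ₖ p.2) (by
      refine continuous_matrix fun i j => ?_
      simp only [Matrix.kroneckerMap_apply]
      fun_prop)
  convert this using 1
  ext X
  simp only [productStates, mem_ofPred_eq, mem_image, mem_prod, Prod.exists]
  exact ⟨fun ⟨ρ, σ, h1, h2, h⟩ => ⟨ρ, σ, ⟨h1, h2⟩, h.symm⟩,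
    fun ⟨ρ, σ, ⟨h1, h2⟩, h⟩ => ⟨ρ, σ, h1, h2, h.symm⟩⟩

theorem isState_of_mem_separableStates {X : Matrix (A × B) (A × B) ℂ}
    (hX : X ∈ separableStates A B) : IsState X := by
  refine convexHull_min ?_ convex_setOf_isState hX
  rintro _ ⟨ρ, σ, hρ, hσ, rfl⟩
  exact hρ.kronecker hσ

/-- A Hermitian matrix on a product is a real linear combination of product states. -/
theorem exists_sum_productStates {W : Matrix (A × B) (A × B) ℂ} (hW : W.IsHermitian) :
    ∃ (m : ℕ) (c : Fin m → ℝ) (ρ : Fin m → Matrix A A ℂ) (σ : Fin m → Matrix B B ℂ),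
      (∀ i, IsState (ρ i)) ∧ (∀ i, IsState (σ i)) ∧ W = ∑ i, c i • (ρ i ⊗ₖ σ i) := by
  classical
  have hspan : Submodule.span ℂ (productStates A B) = ⊤ := by
    let kron : Matrix A A ℂ →ₗ[ℂ] Matrix B B ℂ →ₗ[ℂ] Matrix (A × B) (A × B) ℂ :=
      Matrix.kroneckerBilinear
    have h := Submodule.map₂_span_span ℂ kron {ρ | IsState ρ} {σ | IsState σ}
    rw [span_isState_eq_top, span_isState_eq_top] at h
    have h2 : productStates A B = Set.image2
      (fun ρ σ => kron ρ σ) {ρ | IsState ρ} {σ | IsState σ} := by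
      ext X
      simp only [productStates, mem_ofPred_eq, Set.mem_image2]
      exact ⟨fun ⟨ρ, σ, h1, h2, h⟩ => ⟨ρ, h1, σ, h2, h.symm⟩,
        fun ⟨ρ, h1, σ, h2, h⟩ => ⟨ρ, σ, h1, h2, h.symm⟩⟩
    rw [h2, ← h]
    refine eq_top_iff.2 fun X _ => ?_
    rw [Matrix.matrix_eq_sum_single X]
    refine Submodule.sum_mem _ fun p _ => Submodule.sum_mem _ fun q _ => ?_
    have h3 : Matrix.single p q (X p q) =
        kron (Matrix.single p.1 q.1 (X p q)) (Matrix.single p.2 q.2 1) := by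
      change _ = Matrix.single p.1 q.1 (X p q) ⊗ₖ Matrix.single p.2 q.2 1
      rw [Matrix.single_kronecker_single, mul_one]
    rw [h3]
    exact Submodule.apply_mem_map₂ _ trivial trivial
  have hmem : W ∈ Submodule.span ℂ (productStates A B) := hspan ▸ trivial
  obtain ⟨m, c, g, hW'⟩ := Submodule.mem_span_set'.1 hmem
  choose ρ σ hρ hσ hg using fun i => (g i).2
  refine ⟨m, fun i => (c i).re, ρ, σ, hρ, hσ, ?_⟩
  -- Product states are Hermitian, so averaging with the adjoint replaces complex coefficients by
  -- their real parts.
  have h2 : W + Wᴴ = (2 : ℝ) • ∑ i, (c i).re • (ρ i ⊗ₖ σ i) := by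
    rw [← hW', Matrix.conjTranspose_sum, ← Finset.sum_add_distrib, Finset.smul_sum]
    refine Finset.sum_congr rfl fun i _ => ?_
    rw [Matrix.conjTranspose_smul, hg, ((hρ i).kronecker (hσ i)).1.isHermitian.eq, ← add_smul,
      smul_smul, ← Complex.coe_smul]
    congr 1
    exact Complex.ext (by simp; ring) (by simp)
  rw [hW.eq, ← two_smul ℝ W] at h2
  exact smul_right_injective _ (two_ne_zero' ℝ) h2

end Separable

/-! ### Cones over sets of states -/

section ConeOver

variable {n : Type*} {T : Set (Matrix n n ℂ)}

/-- Elements of `T` have trace one, so the scale `t` must be twice the real trace of `X`. Only `b`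
remains existential, and it ranges over a compact set. -/
theorem isClosed_coneOver [Fintype n] (hT : IsCompact T) (hstate : ∀ X ∈ T, IsState X) :
    IsClosed (coneOver T) := by
  have : coneOver T = {X | 0 ≤ X.trace.re} ∩ {X | ∃ b ∈ T, (X, b) ∈
      {p : Matrix n n ℂ × Matrix n n ℂ | p.1 + p.1ᴴ = (2 * p.1.trace.re) • p.2}} := by
    ext X
    simp only [coneOver, mem_ofPred_eq, mem_inter_iff]
    constructor
    · rintro ⟨t, ht, b, hb, h⟩
      have h1 : 2 * X.trace.re = t := by
        have := congrArg (fun Y => Y.trace.re) h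
        simp [Matrix.trace_conjTranspose, (hstate b hb).2] at this
        linarith
      exact ⟨by linarith, b, hb, h1.symm ▸ h⟩
    · rintro ⟨h0, b, hb, h⟩
      exact ⟨_, by positivity, b, hb, h⟩
  rw [this]
  have htr : Continuous fun X : Matrix n n ℂ => X.trace.re :=
    Complex.continuous_re.comp (by fun_prop)
  refine (isClosed_le continuous_const htr).inter
    (isClosed_exists_mem_of_isCompact hT (isClosed_eq (by fun_prop) ?_))
  exact ((htr.comp continuous_fst).const_mul 2).smul continuous_snd

theorem smul_mem_coneOver (t : ℝ) (ht : 0 ≤ t) (X : Matrix n n ℂ) (hX : X ∈ coneOver T) :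
    t • X ∈ coneOver T := by
  obtain ⟨s, hs, b, hb, h⟩ := hX
  refine ⟨t * s, by positivity, b, hb, ?_⟩
  rw [Matrix.conjTranspose_smul, star_trivial, ← smul_add, h, smul_smul]

theorem add_mem_coneOver (hT : Convex ℝ T) {X Y : Matrix n n ℂ} (hX : X ∈ coneOver T)
    (hY : Y ∈ coneOver T) : X + Y ∈ coneOver T := by
  obtain ⟨s, hs, b, hb, h⟩ := hX
  obtain ⟨t, ht, c, hc, h'⟩ := hY
  have hsum : X + Y + (X + Y)ᴴ = s • b + t • c := by
    rw [Matrix.conjTranspose_add, ← h, ← h']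
    abel
  rcases (add_nonneg hs ht).eq_or_lt with h0 | h0
  · have hs0 : s = 0 := by linarith
    have ht0 : t = 0 := by linarith
    exact ⟨0, le_rfl, b, hb, by rw [hsum, hs0, ht0]; simp⟩
  · refine ⟨s + t, h0.le, _, hT hb hc (div_nonneg hs h0.le) (div_nonneg ht h0.le)
      (by field_simp), ?_⟩
    rw [hsum, smul_add, smul_smul, smul_smul, mul_div_cancel₀ _ h0.ne', mul_div_cancel₀ _ h0.ne']

theorem convex_coneOver (hT : Convex ℝ T) : Convex ℝ (coneOver T) := fun _ hX _ hY _ _ ha hb _ =>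
  add_mem_coneOver hT (smul_mem_coneOver _ ha _ hX) (smul_mem_coneOver _ hb _ hY)

theorem mem_coneOver_of_smul {X b : Matrix n n ℂ} {t : ℝ} (ht : 0 ≤ t) (hb : b ∈ T)
    (hbh : b.IsHermitian) (h : X = t • b) : X ∈ coneOver T :=
  ⟨2 * t, by positivity, b, hb, by
    rw [h, Matrix.conjTranspose_smul, star_trivial, hbh.eq, mul_smul, two_smul]⟩

theorem mem_coneOver_iff_of_isHermitian {X : Matrix n n ℂ} (hX : X.IsHermitian) :
    X ∈ coneOver T ↔ ∃ t : ℝ, 0 ≤ t ∧ ∃ b ∈ T, X = t • b := by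
  have h2 : X + Xᴴ = (2 : ℝ) • X := by rw [hX.eq, two_smul]
  constructor
  · rintro ⟨t, ht, b, hb, h⟩
    refine ⟨t / 2, by positivity, b, hb, ?_⟩
    rw [h2] at h
    rw [div_eq_inv_mul, mul_smul, ← h, smul_smul]
    norm_num
  · rintro ⟨t, ht, b, hb, h⟩
    exact ⟨2 * t, by positivity, b, hb, by rw [h2, h, mul_smul]⟩

end ConeOver

/-! ### The identity as an order unit -/

section Interior

variable {A B : Type*} [Fintype A] [Fintype B]

theorem kronecker_mem_coneOver [Nonempty A] [Nonempty B] {T : Set (Matrix (A × B) (A × B) ℂ)}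
    (hsep : separableStates A B ⊆ T)
    {P : Matrix A A ℂ} {Q : Matrix B B ℂ} (hP : P.PosSemidef) (hQ : Q.PosSemidef) :
    P ⊗ₖ Q ∈ coneOver T := by
  obtain ⟨ρ, hρ, hPρ⟩ := exists_isState_smul_eq hP
  obtain ⟨σ, hσ, hQσ⟩ := exists_isState_smul_eq hQ
  refine mem_coneOver_of_smul (t := P.trace.re * Q.trace.re) (b := ρ ⊗ₖ σ)
    (mul_nonneg (Complex.nonneg_iff.1 hP.trace_nonneg).1 (Complex.nonneg_iff.1 hQ.trace_nonneg).1)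
    (hsep (subset_convexHull ℝ _ ⟨ρ, σ, hρ, hσ, rfl⟩)) (hρ.kronecker hσ).1.isHermitian ?_
  conv_lhs => rw [hPρ, hQσ]
  rw [Matrix.smul_kronecker, Matrix.kronecker_smul, smul_smul]

/-- The identity is an interior point of the separable cone, and of every larger one. -/
theorem one_mem_interior_coneOver [DecidableEq A] [DecidableEq B] [Nonempty A] [Nonempty B]
    {T : Set (Matrix (A × B) (A × B) ℂ)} (hT : Convex ℝ T) (hsep : separableStates A B ⊆ T) :
    (1 : Matrix (A × B) (A × B) ℂ) ∈ interior (coneOver T) := by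
  have h1 : (1 : Matrix (A × B) (A × B) ℂ) ∈ coneOver T := by
    rw [← Matrix.one_kronecker_one]
    exact kronecker_mem_coneOver hsep Matrix.PosSemidef.one Matrix.PosSemidef.one
  have h0 : (0 : Matrix (A × B) (A × B) ℂ) ∈ coneOver T := by
    simpa using smul_mem_coneOver 0 le_rfl _ h1
  have hprod : ∀ (ρ : Matrix A A ℂ) (σ : Matrix B B ℂ), IsState ρ → IsState σ → ∀ c : ℝ,
      |c| • (1 : Matrix (A × B) (A × B) ℂ) + c • (ρ ⊗ₖ σ) ∈ coneOver T := by
    intro ρ σ hρ hσ c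
    rcases abs_cases c with ⟨h, hc⟩ | ⟨h, hc⟩
    · rw [h]
      exact add_mem_coneOver hT (smul_mem_coneOver _ hc _ h1)
        (smul_mem_coneOver _ hc _ (kronecker_mem_coneOver hsep hρ.1 hσ.1))
    -- `1 ⊗ 1 - ρ ⊗ σ = (1 - ρ) ⊗ 1 + ρ ⊗ (1 - σ)`, a sum of products of positive matrices.
    · have h2 := add_mem_coneOver hT
        (kronecker_mem_coneOver hsep hρ.posSemidef_one_sub (Matrix.PosSemidef.one (n := B)))
        (kronecker_mem_coneOver hsep hρ.1 hσ.posSemidef_one_sub)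
      convert smul_mem_coneOver (-c) (by linarith) _ h2 using 1
      rw [h, sub_eq_add_neg 1 ρ, sub_eq_add_neg 1 σ, Matrix.add_kronecker, Matrix.kronecker_add,
        ← neg_one_smul ℝ ρ, ← neg_one_smul ℝ σ, Matrix.smul_kronecker, Matrix.kronecker_smul,
        Matrix.one_kronecker_one]
      module
  refine mem_interior_of_forall_exists_add_mem (convex_coneOver hT) smul_mem_coneOver h1
    fun W => ?_
  obtain ⟨m, c, ρ, σ, hρ, hσ, hW⟩ := exists_sum_productStates
    (W := W + Wᴴ) (by rw [Matrix.IsHermitian, Matrix.conjTranspose_add,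
      Matrix.conjTranspose_conjTranspose, add_comm])
  -- Halved because adding the adjoint doubles the multiple of the identity.
  refine ⟨(∑ i, |c i|) / 2, by positivity, ?_⟩
  have h3 : ∑ i, (|c i| • (1 : Matrix (A × B) (A × B) ℂ) + c i • (ρ i ⊗ₖ σ i)) ∈ coneOver T :=
    Finset.sum_induction _ (· ∈ coneOver T) (fun _ _ hX hY => add_mem_coneOver hT hX hY) h0
      fun i _ => hprod _ _ (hρ i) (hσ i) _
  rw [Finset.sum_add_distrib, ← hW, ← Finset.sum_smul, mem_coneOver_iff_of_isHermitian] at h3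
  · obtain ⟨t, ht, b, hb, h⟩ := h3
    refine ⟨t, ht, b, hb, ?_⟩
    rw [← h, Matrix.conjTranspose_add, Matrix.conjTranspose_smul, star_trivial,
      Matrix.conjTranspose_one]
    module
  · rw [Matrix.IsHermitian, Matrix.conjTranspose_add, Matrix.conjTranspose_smul, star_trivial,
      Matrix.conjTranspose_one, Matrix.conjTranspose_add, Matrix.conjTranspose_conjTranspose,
      add_comm W]

end Interior

end QMemory

/-! ### Choi matrices and game operators -/

noncomputable section

namespace QMemory

open Set Filter Topology

/-- The linear map with a given Choi matrix. -/
def mapOfChoi {A B : Type*} [Fintype A] (X : Matrix (A × B) (A × B) ℂ) :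
    Matrix A A ℂ →ₗ[ℂ] Matrix B B ℂ where
  toFun ρ := Matrix.of fun b b' => (Fintype.card A : ℂ) * ∑ a, ∑ a', ρ a a' * X (a, b) (a', b')
  map_add' ρ ρ' := by
    ext b b'
    simp [add_mul, Finset.sum_add_distrib, mul_add]
  map_smul' c ρ := by
    ext b b'
    simp [mul_assoc, ← Finset.mul_sum, mul_left_comm _ c]

theorem mapOfChoi_apply {A B : Type*} [Fintype A] (X : Matrix (A × B) (A × B) ℂ)
    (ρ : Matrix A A ℂ) (b b' : B) :
    mapOfChoi X ρ b b' = (Fintype.card A : ℂ) * ∑ a, ∑ a', ρ a a' * X (a, b) (a', b') := rfl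

/-- The partial trace over the second factor. -/
def partialTrace {A B : Type*} [Fintype B] : Matrix (A × B) (A × B) ℂ →ₗ[ℝ] Matrix A A ℂ where
  toFun X := Matrix.of fun a a' => ∑ b, X (a, b) (a', b)
  map_add' X Y := by
    ext
    simp [Finset.sum_add_distrib]
  map_smul' c X := by
    ext
    simp [Finset.mul_sum]

theorem partialTrace_apply {A B : Type*} [Fintype B] (X : Matrix (A × B) (A × B) ℂ) (a a' : A) :
    partialTrace X a a' = ∑ b, X (a, b) (a', b) := rfl

theorem partialTrace_kronecker {A B : Type*} [Fintype B] (X : Matrix A A ℂ) (Y : Matrix B B ℂ) :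
    partialTrace (X ⊗ₖ Y) = Y.trace • X := by
  ext a a'
  simp [partialTrace_apply, Matrix.trace, Finset.mul_sum, mul_comm]

theorem Game.isHermitian_witness {A B : Type*} [Fintype A] [Fintype B] [DecidableEq B]
    (G : Game A B) : G.witness.IsHermitian := by
  have h : ∀ i j, ((G.σ i)ᵀ ⊗ₖ G.O j)ᴴ = (G.σ i)ᵀ ⊗ₖ G.O j := fun i j =>
    ((G.isState i).1.transpose.kronecker (G.isPOVM.1 j)).isHermitian
  rw [Matrix.IsHermitian, Game.witness]
  simp only [Matrix.conjTranspose_smul, Matrix.conjTranspose_sum, h, Complex.star_def,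
    Complex.conj_ofReal, Complex.conj_natCast]

theorem trace_mul_eq_ofReal_re {n : Type*} [Fintype n] {X Y : Matrix n n ℂ} (hX : X.IsHermitian)
    (hY : Y.IsHermitian) : (((X * Y).trace.re : ℝ) : ℂ) = (X * Y).trace := by
  refine Complex.conj_eq_iff_re.1 ?_
  rw [← Complex.star_def, ← Matrix.trace_conjTranspose, Matrix.conjTranspose_mul, hX.eq, hY.eq,
    Matrix.trace_mul_comm]

/-- Expand `W` in product states `ρ i ⊗ σ i`. The inputs are the `(ρ i)ᵀ`; the effects `σ i / m` sum
to at most `1` and are completed to a POVM by one extra outcome. -/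
theorem exists_game_witness_eq {A B : Type*} [Fintype A] [Nonempty A] [Fintype B]
    [DecidableEq B] {W : Matrix (A × B) (A × B) ℂ} (hW : W.IsHermitian) :
    ∃ G : Game A B, G.witness = W := by
  have hd : (Fintype.card A : ℂ) ≠ 0 := by simp
  obtain ⟨m, c, ρ, σ, hρ, hσ, h⟩ := exists_sum_productStates hW
  have hpos : (1 - ∑ i, (m : ℝ)⁻¹ • σ i).PosSemidef := by
    rcases Nat.eq_zero_or_pos m with rfl | hm
    · simpa using Matrix.PosSemidef.one
    · have : (1 : Matrix B B ℂ) - ∑ i, (m : ℝ)⁻¹ • σ i = ∑ i, (m : ℝ)⁻¹ • (1 - σ i) := by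
        simp only [smul_sub, Finset.sum_sub_distrib]
        rw [Finset.sum_const, Finset.card_univ, Fintype.card_fin, ← Nat.cast_smul_eq_nsmul ℝ,
          smul_smul, mul_inv_cancel₀ (by positivity), one_smul]
      rw [this]
      exact Matrix.posSemidef_sum _ fun i _ => (hσ i).posSemidef_one_sub.smul (by positivity)
  let G : Game A B :=
    { nIn := m
      nOut := m + 1
      -- The extra outcome pays nothing, and input `i` pays only on outcome `i`. The factors `m` and
      -- `1 / d` cancel the effect's weight and the prefactor of `Game.witness`.
      α := fun i => Fin.cons 0 (Pi.single i (m * c i * (Fintype.card A : ℝ)⁻¹))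
      σ := fun i => (ρ i)ᵀ
      O := Fin.cons (1 - ∑ i, (m : ℝ)⁻¹ • σ i) fun i => (m : ℝ)⁻¹ • σ i
      isState := fun i => (hρ i).transpose
      isPOVM := ⟨fun j => by
        refine Fin.cases ?_ (fun i => ?_) j
        · simpa using hpos
        · simpa using (hσ i).1.smul (a := (m : ℝ)⁻¹) (by positivity), by
        rw [Fin.sum_univ_succ]
        simp⟩ }
  refine ⟨G, ?_⟩
  rw [h]
  change (Fintype.card A : ℂ) • ∑ i, ∑ j, (G.α i j : ℂ) • ((ρ i)ᵀᵀ ⊗ₖ G.O j) = _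
  rw [Finset.smul_sum]
  refine Finset.sum_congr rfl fun i _ => ?_
  have hm : (m : ℂ) ≠ 0 := by exact_mod_cast (Fin.pos (n := m) i).ne'
  rw [Fin.sum_univ_succ, Finset.sum_eq_single i]
  · simp only [G, Fin.cons_zero, Fin.cons_succ, Pi.single_eq_same, Matrix.transpose_transpose,
      Complex.ofReal_zero, zero_smul, zero_add, Matrix.kronecker_smul, ← Complex.coe_smul,
      smul_smul]
    congr 1
    push_cast
    field_simp
  · intro j _ hj
    simp [G, hj]
  · simp

variable {A B : Type*} [Fintype A] [DecidableEq A]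

theorem choi_apply (N : Matrix A A ℂ →ₗ[ℂ] Matrix B B ℂ) (p q : A × B) :
    choi N p q = (Fintype.card A : ℂ)⁻¹ * N (Matrix.single p.1 q.1 1) p.2 q.2 := by
  have : (Matrix.of fun a a' => maxEntangled A (p.1, a) (q.1, a')) =
      (Fintype.card A : ℂ)⁻¹ • Matrix.single p.1 q.1 (1 : ℂ) := by
    ext a a'
    simp [maxEntangled, Matrix.single_apply]
  change N (Matrix.of fun a a' => maxEntangled A (p.1, a) (q.1, a')) p.2 q.2 = _
  rw [this, map_smul, Matrix.smul_apply, smul_eq_mul]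

theorem choi_add_smul (N M : Matrix A A ℂ →ₗ[ℂ] Matrix B B ℂ) (a b : ℝ) :
    choi (a • N + b • M) = a • choi N + b • choi M := by
  ext p q
  simp only [choi_apply, LinearMap.add_apply, LinearMap.smul_apply, Matrix.add_apply,
    Matrix.smul_apply, Complex.real_smul]
  ring

theorem mapOfChoi_choi [Nonempty A] (N : Matrix A A ℂ →ₗ[ℂ] Matrix B B ℂ) :
    mapOfChoi (choi N) = N := by
  have hd : (Fintype.card A : ℂ) ≠ 0 := by simp
  ext ρ b b'
  have hρ : N ρ b b' = ∑ a, ∑ a', ρ a a' * N (Matrix.single a a' 1) b b' := by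
    conv_lhs => rw [Matrix.matrix_eq_sum_single ρ]
    simp only [map_sum, Matrix.sum_apply]
    refine Finset.sum_congr rfl fun a _ => Finset.sum_congr rfl fun a' _ => ?_
    rw [← mul_one (ρ a a'), ← smul_eq_mul, ← Matrix.smul_single, map_smul, Matrix.smul_apply]
    simp
  rw [mapOfChoi_apply, hρ, Finset.mul_sum]
  refine Finset.sum_congr rfl fun a _ => ?_
  rw [Finset.mul_sum]
  refine Finset.sum_congr rfl fun a' _ => ?_
  rw [choi_apply]
  field_simp

theorem choi_mapOfChoi [Nonempty A] (X : Matrix (A × B) (A × B) ℂ) : choi (mapOfChoi X) = X := by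
  have hd : (Fintype.card A : ℂ) ≠ 0 := by simp
  ext ⟨a, b⟩ ⟨a', b'⟩
  rw [choi_apply, mapOfChoi_apply, inv_mul_cancel_left₀ hd]
  simp [Matrix.single_apply, ite_and]

variable [Fintype B]

/-- The elements of `T` whose marginal on the first factor is maximally mixed. -/
def uniformMarginal (T : Set (Matrix (A × B) (A × B) ℂ)) : Set (Matrix (A × B) (A × B) ℂ) :=
  {X | X ∈ T ∧ partialTrace X = (Fintype.card A : ℂ)⁻¹ • 1}

/-- The entries of the marginal are, up to `1 / d`, the traces of the images of the matrix units. -/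
theorem tracePreserving_iff [Nonempty A] (N : Matrix A A ℂ →ₗ[ℂ] Matrix B B ℂ) :
    (∀ X, (N X).trace = X.trace) ↔ partialTrace (choi N) = (Fintype.card A : ℂ)⁻¹ • 1 := by
  have hd : (Fintype.card A : ℂ) ≠ 0 := by simp
  have hp : ∀ a a', partialTrace (choi N) a a' =
      (Fintype.card A : ℂ)⁻¹ * (N (Matrix.single a a' 1)).trace := fun a a' => by
    simp [partialTrace_apply, choi_apply, Matrix.trace, Finset.mul_sum]
  constructor
  · intro h
    ext a a'
    rw [hp, h, Matrix.smul_apply, smul_eq_mul, Matrix.one_apply]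
    split_ifs with haa
    · rw [haa, Matrix.trace_single_eq_same]
    · rw [Matrix.trace_single_eq_of_ne _ _ _ haa]
  · intro h
    have h1 : ∀ a a', (N (Matrix.single a a' 1)).trace = (1 : Matrix A A ℂ) a a' := fun a a' => by
      have := hp a a'
      rw [h, Matrix.smul_apply, smul_eq_mul] at this
      exact (mul_left_cancel₀ (inv_ne_zero hd) this).symm
    have h2 : Matrix.traceLinearMap B ℂ ℂ ∘ₗ N = Matrix.traceLinearMap A ℂ ℂ := by
      refine Matrix.ext_linearMap ℂ fun a a' => LinearMap.ext_ring ?_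
      simp only [LinearMap.comp_apply, Matrix.singleLinearMap_apply, Matrix.traceLinearMap_apply]
      rw [h1, Matrix.one_apply]
      split_ifs with haa
      · rw [haa, Matrix.trace_single_eq_same]
      · rw [Matrix.trace_single_eq_of_ne _ _ _ haa]
    exact fun X => LinearMap.congr_fun h2 X

/-- Measuring `P i` and preparing `σ i` contributes `(P i)ᵀ ⊗ σ i / d` to the Choi matrix.
Conversely a term `w • (ρ ⊗ σ)` gives the effect `d • w • ρᵀ`, and the marginal condition says that
the effects sum to `1`. -/
theorem isEB_iff [Nonempty A] (N : Matrix A A ℂ →ₗ[ℂ] Matrix B B ℂ) :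
    IsEB N ↔ choi N ∈ uniformMarginal (separableStates A B) := by
  have hd : (Fintype.card A : ℂ) ≠ 0 := by simp
  have hdr : (Fintype.card A : ℝ) ≠ 0 := by simp
  constructor
  · rintro ⟨n, P, σ, ⟨hP, hP1⟩, hσ, hN⟩
    refine ⟨?_, (tracePreserving_iff N).1 fun X => ?_⟩
    · choose ρ hρ hPρ using fun i => exists_isState_smul_eq (hP i).transpose
      have hchoi : choi N =
          ∑ i, ((P i)ᵀ.trace.re * (Fintype.card A : ℝ)⁻¹) • (ρ i ⊗ₖ σ i) := by
        have : choi N = ∑ i, (Fintype.card A : ℝ)⁻¹ • ((P i)ᵀ ⊗ₖ σ i) := by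
          ext p q
          rw [choi_apply, hN, Matrix.sum_apply, Matrix.sum_apply, Finset.mul_sum]
          refine Finset.sum_congr rfl fun i _ => ?_
          simp [Matrix.trace_single_mul]
        rw [this]
        refine Finset.sum_congr rfl fun i _ => ?_
        conv_lhs => rw [hPρ i]
        rw [Matrix.smul_kronecker, smul_smul, mul_comm]
      rw [hchoi]
      refine (convex_convexHull ℝ _).sum_mem (fun i _ => ?_) ?_
        fun i _ => subset_convexHull ℝ _ ⟨ρ i, σ i, hρ i, hσ i, rfl⟩
      · exact mul_nonneg (Complex.nonneg_iff.1 (hP i).transpose.trace_nonneg).1 (by positivity)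
      · rw [← Finset.sum_mul]
        simp only [Matrix.trace_transpose]
        rw [← Complex.re_sum, ← Matrix.trace_sum, hP1, Matrix.trace_one, Complex.natCast_re,
          mul_inv_cancel₀ hdr]
    · rw [hN, Matrix.trace_sum]
      simp only [Matrix.trace_smul, (hσ _).2, smul_eq_mul, mul_one]
      rw [← Matrix.trace_sum, ← Finset.mul_sum, hP1, mul_one]
  · rintro ⟨hsep, hmarg⟩
    obtain ⟨ι, _, w, z, hw, hw1, hz, hX⟩ := mem_convexHull_iff_exists_fintype.1 hsep
    choose ρ σ hρ hσ hz using hz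
    let e := Fintype.equivFin ι
    refine ⟨Fintype.card ι, fun i => ((Fintype.card A : ℝ) * w (e.symm i)) • (ρ (e.symm i))ᵀ,
      fun i => σ (e.symm i), ⟨fun i => ?_, ?_⟩, fun i => hσ _, fun τ => ?_⟩
    · exact (hρ _).1.transpose.smul (mul_nonneg (by positivity) (hw _))
    · rw [e.symm.sum_comp fun k => ((Fintype.card A : ℝ) * w k) • (ρ k)ᵀ]
      have h1 : ∑ k, w k • ρ k = (Fintype.card A : ℂ)⁻¹ • 1 := by
        rw [← hmarg, ← hX, map_sum]
        refine Finset.sum_congr rfl fun k _ => ?_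
        rw [map_smul, hz, partialTrace_kronecker, (hσ k).2, one_smul]
      have h2 := congrArg Matrix.transpose h1
      rw [Matrix.transpose_sum, Matrix.transpose_smul, Matrix.transpose_one] at h2
      simp only [Matrix.transpose_smul] at h2
      simp only [mul_smul]
      rw [← Finset.smul_sum, h2, ← Complex.coe_smul, smul_smul]
      simp [hd]
    · rw [e.symm.sum_comp fun k => (τ * ((Fintype.card A : ℝ) * w k) • (ρ k)ᵀ).trace • σ k]
      conv_lhs => rw [← mapOfChoi_choi N, ← hX]
      ext b b'
      rw [mapOfChoi_apply, Matrix.sum_apply]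
      simp only [Matrix.sum_apply, Matrix.smul_apply, Finset.mul_sum, hz, Matrix.kronecker_apply,
        Matrix.trace, Matrix.diag, Matrix.mul_apply, Matrix.transpose_apply, smul_eq_mul,
        Complex.real_smul, Complex.ofReal_mul, Complex.ofReal_natCast, Finset.sum_mul]
      rw [Finset.sum_comm' (t' := Finset.univ) (s' := fun _ => Finset.univ) (by simp)]
      conv_rhs => rw [Finset.sum_comm]
      rw [Finset.sum_comm]
      refine Finset.sum_congr rfl fun a _ => ?_
      conv_rhs => rw [Finset.sum_comm]
      refine Finset.sum_congr rfl fun a' _ => Finset.sum_congr rfl fun k _ => ?_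
      ring

theorem posSemidef_maxEntangled : (maxEntangled A).PosSemidef := by
  let v : A × A → ℂ := fun p => if p.1 = p.2 then 1 else 0
  have : maxEntangled A = (Fintype.card A : ℂ)⁻¹ • Matrix.vecMulVec v (star v) := by
    ext p q
    by_cases hp : p.1 = p.2 <;> by_cases hq : q.1 = q.2 <;>
      simp [maxEntangled, v, Matrix.vecMulVec_apply, hp, hq]
  rw [this]
  exact (Matrix.posSemidef_vecMulVec_self_star v).smul (by positivity)

theorem isCompletelyPositive_iff [Nonempty A] (N : Matrix A A ℂ →ₗ[ℂ] Matrix B B ℂ) :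
    IsCompletelyPositive N ↔ (choi N).PosSemidef := by
  classical
  constructor
  · intro h
    let e := Fintype.equivFin A
    have := h (Fintype.card A) _
      ((posSemidef_maxEntangled (A := A)).submatrix fun p => (e.symm p.1, p.2))
    convert this.submatrix (fun p : A × B => (e p.1, p.2)) using 1
    ext p q
    simp [choi, ampliation]
  · intro h k X hX
    -- Teleportation: `V` contracts the `A` of `X` against the `A` of the Choi matrix, so the output
    -- is a congruence of `X ⊗ₖ choi N`.
    let V : Matrix ((Fin k × A) × (A × B)) (Fin k × B) ℂ := Matrix.of fun p q =>
      if p.1.1 = q.1 ∧ p.2.2 = q.2 ∧ p.1.2 = p.2.1 then 1 else 0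
    have key : ampliation (Fin k) N X = (Fintype.card A : ℂ) • (Vᴴ * (X ⊗ₖ choi N) * V) := by
      ext p q
      conv_lhs => rw [← mapOfChoi_choi N]
      change mapOfChoi (choi N) (Matrix.of fun a a' => X (p.1, a) (q.1, a')) p.2 q.2 = _
      rw [mapOfChoi_apply]
      simp [V, Matrix.mul_apply, Fintype.sum_prod_type, ite_and, apply_ite]
      rw [Finset.sum_comm]
    rw [key]
    exact ((hX.kronecker h).conjTranspose_mul_mul_same V).smul (by positivity)

theorem trace_eq_one_of_partialTrace [Nonempty A] {X : Matrix (A × B) (A × B) ℂ}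
    (h : partialTrace X = (Fintype.card A : ℂ)⁻¹ • 1) : X.trace = 1 := by
  have : X.trace = (partialTrace X).trace := by
    simp [Matrix.trace, partialTrace_apply, Fintype.sum_prod_type]
  rw [this, h, Matrix.trace_smul, Matrix.trace_one]
  simp

theorem isChannel_iff [Nonempty A] (N : Matrix A A ℂ →ₗ[ℂ] Matrix B B ℂ) :
    IsChannel N ↔ choi N ∈ uniformMarginal {X | IsState X} := by
  rw [IsChannel, isCompletelyPositive_iff, tracePreserving_iff]
  exact ⟨fun ⟨h, h'⟩ => ⟨⟨h, trace_eq_one_of_partialTrace h'⟩, h'⟩, fun ⟨h, h'⟩ => ⟨h.1, h'⟩⟩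

theorem trace_choi_mul_kronecker [Nonempty A] (N : Matrix A A ℂ →ₗ[ℂ] Matrix B B ℂ)
    (ρ : Matrix A A ℂ) (Y : Matrix B B ℂ) :
    (Fintype.card A : ℂ) * (choi N * (ρᵀ ⊗ₖ Y)).trace = (N ρ * Y).trace := by
  conv_rhs => rw [← mapOfChoi_choi N]
  simp only [Matrix.trace, Matrix.diag, Matrix.mul_apply, mapOfChoi_apply, Fintype.sum_prod_type,
    Matrix.kronecker_apply, Matrix.transpose_apply, Finset.mul_sum, Finset.sum_mul]
  rw [Finset.sum_comm]
  refine Finset.sum_congr rfl fun b _ => ?_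
  conv_rhs => rw [Finset.sum_comm]
  refine Finset.sum_congr rfl fun a _ => ?_
  rw [Finset.sum_comm]
  refine Finset.sum_congr rfl fun b' _ => Finset.sum_congr rfl fun a' _ => ?_
  ring

variable [DecidableEq B]

theorem trace_choi_mul_witness [Nonempty A] (N : Matrix A A ℂ →ₗ[ℂ] Matrix B B ℂ) (G : Game A B) :
    (choi N * G.witness).trace = ∑ i, ∑ j, (G.α i j : ℂ) * (N (G.σ i) * G.O j).trace := by
  rw [Game.witness, Matrix.mul_smul, Matrix.trace_smul, Finset.mul_sum, Matrix.trace_sum,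
    Finset.smul_sum]
  refine Finset.sum_congr rfl fun i _ => ?_
  rw [Finset.mul_sum, Matrix.trace_sum, Finset.smul_sum]
  refine Finset.sum_congr rfl fun j _ => ?_
  rw [Matrix.mul_smul, Matrix.trace_smul, ← trace_choi_mul_kronecker, smul_eq_mul, smul_eq_mul]
  ring

theorem payoff_eq [Nonempty A] (N : Matrix A A ℂ →ₗ[ℂ] Matrix B B ℂ) (G : Game A B) :
    payoff N G = (choi N * G.witness).trace.re := by
  rw [trace_choi_mul_witness, payoff, Complex.re_sum]
  refine Finset.sum_congr rfl fun i _ => ?_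
  rw [Complex.re_sum]
  exact Finset.sum_congr rfl fun j _ => (Complex.re_ofReal_mul _ _).symm

end QMemory

end

/-! ### Robustness as a conic program -/

noncomputable section

namespace QMemory

open Set Filter Topology

/-- On Hermitian matrices every real functional is the trace pairing with a Hermitian matrix. -/
theorem exists_isHermitian_eq_trace {n : Type*} [Fintype n] [DecidableEq n]
    (f : Matrix n n ℂ →ₗ[ℝ] ℝ) :
    ∃ W : Matrix n n ℂ, W.IsHermitian ∧ ∀ X, X.IsHermitian → f X = (X * W).trace.re := by
  -- `g` is complex linear with real part `f`; the Hermitian part of its matrix has the same real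
  -- pairing with Hermitian `X`.
  let g : Module.Dual ℂ (Matrix n n ℂ) := Module.Dual.extendRCLike f
  have hg : ∀ X, (g X).re = f X := fun X => by
    simp [g, Module.Dual.extendRCLike_apply]
  let Z : Matrix n n ℂ := Matrix.of fun q p => g (Matrix.single p q 1)
  have hZ : ∀ X, g X = (X * Z).trace := fun X => by
    conv_lhs => rw [Matrix.matrix_eq_sum_single X]
    simp only [map_sum, Matrix.trace, Matrix.diag, Matrix.mul_apply]
    refine Finset.sum_congr rfl fun p _ => Finset.sum_congr rfl fun q _ => ?_
    rw [← mul_one (X p q), ← smul_eq_mul, ← Matrix.smul_single, map_smul, smul_eq_mul,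
      smul_eq_mul, mul_one]
    rfl
  refine ⟨(1 / 2 : ℝ) • (Z + Zᴴ), ?_, fun X hX => ?_⟩
  · rw [Matrix.IsHermitian, Matrix.conjTranspose_smul, Matrix.conjTranspose_add,
      Matrix.conjTranspose_conjTranspose, star_trivial, add_comm]
  · have h : (X * Zᴴ).trace = star (X * Z).trace := by
      rw [← Matrix.trace_conjTranspose, Matrix.conjTranspose_mul, hX.eq, Matrix.trace_mul_comm]
    rw [Matrix.mul_smul, Matrix.trace_smul, Matrix.mul_add, Matrix.trace_add, h, ← hZ, ← hg]
    simp only [Complex.smul_re, Complex.add_re, Complex.star_def, Complex.conj_re, smul_eq_mul]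
    ring

variable {A B : Type*} [Fintype A] [DecidableEq A] [Fintype B]

theorem isCompact_uniformMarginal {T : Set (Matrix (A × B) (A × B) ℂ)} (hT : IsCompact T) :
    IsCompact (uniformMarginal T) :=
  hT.inter_right (isClosed_eq (LinearMap.continuous_of_finiteDimensional _) continuous_const)

theorem convex_uniformMarginal {T : Set (Matrix (A × B) (A × B) ℂ)} (hT : Convex ℝ T) :
    Convex ℝ (uniformMarginal T) := by
  intro X hX Y hY a b ha hb hab
  refine ⟨hT hX.1 hY.1 ha hb hab, ?_⟩
  rw [map_add, map_smul, map_smul, hX.2, hY.2, ← add_smul, hab, one_smul]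

variable [Nonempty A] {T : Set (Matrix (A × B) (A × B) ℂ)}

/-- The robustness sets in terms of Choi matrices. -/
theorem exists_mixture_isEB_iff (hstate : ∀ X ∈ T, IsState X) (hsep : separableStates A B ⊆ T)
    {N : Matrix A A ℂ →ₗ[ℂ] Matrix B B ℂ} (hN : IsChannel N) {s : ℝ} (hs : 0 ≤ s) :
    (∃ M, choi M ∈ uniformMarginal T ∧ IsEB ((1 / (s + 1)) • N + (s / (s + 1)) • M)) ↔
      ∃ e ∈ uniformMarginal (separableStates A B), (1 + s) • e - choi N ∈ coneOver T := by
  have hN' := (isChannel_iff N).1 hN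
  have hs1 : s + 1 ≠ 0 := by positivity
  constructor
  · rintro ⟨M, hM, hE⟩
    refine ⟨_, (isEB_iff _).1 hE, mem_coneOver_of_smul hs hM.1 (hstate _ hM.1).1.isHermitian ?_⟩
    rw [choi_add_smul, smul_add, smul_smul, smul_smul, add_comm 1 s, mul_div_cancel₀ _ hs1,
      mul_div_cancel₀ _ hs1, one_smul, add_sub_cancel_left]
  · rintro ⟨e, he, hc⟩
    have heh : e.IsHermitian := (isState_of_mem_separableStates he.1).1.isHermitian
    rw [mem_coneOver_iff_of_isHermitian] at hc
    swap
    · rw [Matrix.IsHermitian, Matrix.conjTranspose_sub, Matrix.conjTranspose_smul, heh.eq,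
        hN'.1.1.isHermitian.eq, star_trivial]
    obtain ⟨t, ht, b, hb, h⟩ := hc
    have hts : t = s := by
      have := congrArg (fun X => X.trace.re) h
      simpa [(hstate b hb).2, hN'.1.2, (isState_of_mem_separableStates he.1).2, eq_comm] using this
    subst hts
    have hmix : ∀ M, choi M = b → IsEB ((1 / (t + 1)) • N + (t / (t + 1)) • M) := fun M hM => by
      rw [isEB_iff, choi_add_smul, hM]
      convert he using 1
      rw [div_eq_inv_mul t, mul_smul, ← h, smul_sub, smul_smul, add_comm 1 t, inv_mul_cancel₀ hs1]
      module
    -- At `s = 0` the marginal of `b` is unconstrained, but `N` is itself EB and serves as noise.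
    -- For `s > 0` the equal marginals of `e` and `choi N` force that of `b`.
    rcases hs.eq_or_lt with rfl | hpos
    · have hNe : choi N = e := by
        rw [zero_smul, add_zero, one_smul, sub_eq_zero] at h
        exact h.symm
      refine ⟨N, hNe ▸ ⟨hsep he.1, he.2⟩, ?_⟩
      have : (1 / ((0 : ℝ) + 1)) • N + ((0 : ℝ) / (0 + 1)) • N = N := by module
      rw [this, isEB_iff, hNe]
      exact he
    · refine ⟨mapOfChoi b, ?_, hmix _ (choi_mapOfChoi b)⟩
      rw [choi_mapOfChoi]
      refine ⟨hb, ?_⟩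
      have h1 := congrArg partialTrace h
      rw [map_sub, map_smul, map_smul, he.2, hN'.2, add_smul, one_smul, add_sub_cancel_left] at h1
      exact (smul_right_injective _ hpos.ne' h1).symm

variable [DecidableEq B]

/-- Affinity of the payoff solved for `N`: the weak-duality identity. -/
theorem payoff_mixture (N M : Matrix A A ℂ →ₗ[ℂ] Matrix B B ℂ) (G : Game A B) {s : ℝ}
    (hs : 0 ≤ s) : payoff N G =
      (1 + s) * payoff ((1 / (s + 1)) • N + (s / (s + 1)) • M) G - s * payoff M G := by
  have hs1 : s + 1 ≠ 0 := by positivity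
  simp only [payoff_eq, choi_add_smul, Matrix.add_mul, Matrix.smul_mul, Matrix.trace_add,
    Matrix.trace_smul, Complex.add_re, Complex.smul_re, smul_eq_mul]
  field_simp
  ring

variable [Nonempty B]

theorem smul_one_mem_uniformMarginal :
    ((Fintype.card A : ℝ)⁻¹ * (Fintype.card B : ℝ)⁻¹) • (1 : Matrix (A × B) (A × B) ℂ) ∈
      uniformMarginal (separableStates A B) := by
  have h : ((Fintype.card A : ℝ)⁻¹ * (Fintype.card B : ℝ)⁻¹) • (1 : Matrix (A × B) (A × B) ℂ) =
      ((Fintype.card A : ℝ)⁻¹ • (1 : Matrix A A ℂ)) ⊗ₖ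
        ((Fintype.card B : ℝ)⁻¹ • (1 : Matrix B B ℂ)) := by
    rw [Matrix.smul_kronecker, Matrix.kronecker_smul, Matrix.one_kronecker_one, smul_smul]
  rw [h]
  refine ⟨subset_convexHull ℝ _ ⟨_, _, isState_smul_one, isState_smul_one, rfl⟩, ?_⟩
  rw [partialTrace_kronecker, isState_smul_one.2, one_smul, ← Complex.coe_smul]
  simp

/-- Strong duality for both robustnesses at once: `T` is the set of separable states for `R` and of
all states for `R_G`. -/
theorem exists_optimal_witness (hT : IsCompact T) (hTc : Convex ℝ T)
    (hstate : ∀ X ∈ T, IsState X) (hsep : separableStates A B ⊆ T)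
    {N : Matrix A A ℂ →ₗ[ℂ] Matrix B B ℂ} (hN : IsChannel N) {S : Set ℝ}
    (hS : ∀ s, s ∈ S ↔ 0 ≤ s ∧
      ∃ M, choi M ∈ uniformMarginal T ∧ IsEB ((1 / (s + 1)) • N + (s / (s + 1)) • M)) :
    IsLeast S (sInf S) ∧ ∃ G : Game A B,
      (∀ M, choi M ∈ uniformMarginal T → 0 ≤ payoff M G) ∧ (∀ M, IsEB M → payoff M G ≤ 1) ∧
      (∃ M, IsEB M ∧ payoff M G = 1) ∧ payoff N G = 1 + sInf S := by
  have hN' := (isChannel_iff N).1 hN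
  let u := ((Fintype.card A : ℝ)⁻¹ * (Fintype.card B : ℝ)⁻¹) • (1 : Matrix (A × B) (A × B) ℂ)
  have hu : u ∈ interior (coneOver T) := by
    have hc : ((Fintype.card A : ℝ)⁻¹ * (Fintype.card B : ℝ)⁻¹) ≠ 0 := by simp
    have h1 := smul_mem_smul_set (a := (Fintype.card A : ℝ)⁻¹ * (Fintype.card B : ℝ)⁻¹)
      (one_mem_interior_coneOver hTc hsep)
    rw [← interior_smul₀ hc] at h1
    refine interior_mono ?_ h1
    rintro _ ⟨X, hX, rfl⟩
    exact smul_mem_coneOver _ (by positivity) _ hX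
  let τ : Matrix (A × B) (A × B) ℂ →ₗ[ℝ] ℝ := Complex.reLm ∘ₗ Matrix.traceLinearMap (A × B) ℝ ℂ
  have hτ : ∀ X, τ X = X.trace.re := fun X => rfl
  obtain ⟨hleast, f, hf0, hf1, ⟨e, he, hfe⟩, hfN⟩ := exists_dual_of_cone
    (isCompact_uniformMarginal isCompact_separableStates)
    (convex_uniformMarginal (convex_convexHull ℝ _)) (isClosed_coneOver hT hstate)
    (convex_coneOver hTc) smul_mem_coneOver τ
    (fun e he => by rw [hτ, (isState_of_mem_separableStates he.1).2, Complex.one_re])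
    (fun X hX => by
      obtain ⟨t, ht, b, hb, h⟩ := hX
      have := congrArg (fun Y => Y.trace.re) h
      simp [Matrix.trace_conjTranspose, (hstate b hb).2] at this
      rw [hτ]
      linarith)
    (u := u) smul_one_mem_uniformMarginal hu (x := choi N) (by rw [hτ, hN'.1.2, Complex.one_re])
    (S := S) (fun s => (hS s).trans
      (and_congr_right fun hs => exists_mixture_isEB_iff hstate hsep hN hs))
  refine ⟨hleast, ?_⟩
  obtain ⟨W, hW, hfW⟩ := exists_isHermitian_eq_trace f.toLinearMap
  obtain ⟨G, rfl⟩ := exists_game_witness_eq hW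
  have hpay : ∀ M, (choi M).IsHermitian → payoff M G = f (choi M) := fun M hM => by
    rw [payoff_eq]
    exact (hfW _ hM).symm
  have hEB : ∀ M : Matrix A A ℂ →ₗ[ℂ] Matrix B B ℂ, IsEB M → (choi M).IsHermitian := fun M hM =>
    (isState_of_mem_separableStates ((isEB_iff M).1 hM).1).1.isHermitian
  have hE : IsEB (mapOfChoi e) := by rwa [isEB_iff, choi_mapOfChoi]
  refine ⟨G, fun M hM => ?_, fun M hM => ?_, ⟨mapOfChoi e, hE, ?_⟩, ?_⟩
  · have hh := (hstate _ hM.1).1.isHermitian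
    rw [hpay M hh]
    exact hf0 _ (mem_coneOver_of_smul zero_le_one hM.1 hh (one_smul ℝ _).symm)
  · rw [hpay M (hEB M hM)]
    exact hf1 _ ((isEB_iff M).1 hM)
  · rw [hpay _ (hEB _ hE), choi_mapOfChoi, hfe]
  · rw [hpay _ hN'.1.1.isHermitian, hfN]

theorem isGreatest_bestEBPayoff (G : Game A B) : IsGreatest (ebPayoffs G) (bestEBPayoff G) := by
  have h : ebPayoffs G = (fun X => (X * G.witness).trace.re) ''
      uniformMarginal (separableStates A B) := by
    ext p
    constructor
    · rintro ⟨M, hM, rfl⟩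
      exact ⟨choi M, (isEB_iff M).1 hM, (payoff_eq M G).symm⟩
    · rintro ⟨X, hX, rfl⟩
      refine ⟨mapOfChoi X, by rwa [isEB_iff, choi_mapOfChoi], ?_⟩
      rw [payoff_eq, choi_mapOfChoi]
  have hcont : Continuous fun X : Matrix (A × B) (A × B) ℂ => (X * G.witness).trace.re :=
    Complex.continuous_re.comp (by fun_prop)
  have hc : IsCompact (ebPayoffs G) :=
    h ▸ (isCompact_uniformMarginal isCompact_separableStates).image hcont
  exact hc.isGreatest_sSup (h ▸ (Set.Nonempty.image _ ⟨_, smul_one_mem_uniformMarginal⟩))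

end QMemory

end

/-! ### The main theorem -/

theorem theorem3 {A B : Type*} [Fintype A] [DecidableEq A] [Nonempty A]
    [Fintype B] [DecidableEq B]
    (N : Matrix A A ℂ →ₗ[ℂ] Matrix B B ℂ) (hN : QMemory.IsChannel N) :
    -- the minima defining `R(N)` and `R_G(N)` exist
    IsLeast (QMemory.robustnessSet N) (QMemory.robustness N) ∧
    IsLeast (QMemory.genRobustnessSet N) (QMemory.genRobustness N) ∧
    -- the best EB payoff of every game is attained
    (∀ G : QMemory.Game A B, IsGreatest (QMemory.ebPayoffs G) (QMemory.bestEBPayoff G)) ∧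
    -- a game with non-negative EB payoffs whose best EB payoff is zero gives nothing to `N`
    (∀ G : QMemory.Game A B, (∀ M, QMemory.IsEB M → 0 ≤ QMemory.payoff M G) →
      QMemory.bestEBPayoff G = 0 → QMemory.payoff N G = 0) ∧
    -- the maximal advantage over EB channels is `1 + R(N)`
    IsGreatest {r : ℝ | ∃ G : QMemory.Game A B,
        (∀ M, QMemory.IsEB M → 0 ≤ QMemory.payoff M G) ∧
        0 < QMemory.bestEBPayoff G ∧
        r = QMemory.payoff N G / QMemory.bestEBPayoff G}
      (1 + QMemory.robustness N) ∧
    -- the analogous statement for the generalised robustness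
    IsGreatest {r : ℝ | ∃ G : QMemory.Game A B,
        (∀ M, QMemory.IsChannel M → 0 ≤ QMemory.payoff M G) ∧
        (∀ M, QMemory.IsEB M → QMemory.payoff M G ≤ 1) ∧
        r = QMemory.payoff N G}
      (1 + QMemory.genRobustness N) ∧
    -- the payoff is the expectation of the game's Hermitian operator in the Choi state, and
    -- every Hermitian operator comes from a game
    (∀ G : QMemory.Game A B, G.witness.IsHermitian ∧
      ∀ M, QMemory.IsChannel M →
        (QMemory.payoff M G : ℂ) = (QMemory.choi M * G.witness).trace) ∧
    (∀ W : Matrix (A × B) (A × B) ℂ, W.IsHermitian → ∃ G : QMemory.Game A B, G.witness = W) := by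
  open QMemory in
  -- Trace preservation at the identity rules out an empty output system.
  have hB : Nonempty B := by
    by_contra hB
    rw [not_nonempty_iff] at hB
    have := hN.2 1
    rw [Matrix.trace_one, Matrix.trace_eq_zero_of_isEmpty] at this
    exact Nat.cast_ne_zero.2 Fintype.card_ne_zero this.symm
  obtain ⟨hR, G₁, hG₁0, hG₁1, ⟨E₁, hE₁, hE₁1⟩, hG₁N⟩ := exists_optimal_witness
    (T := separableStates A B)
    isCompact_separableStates (convex_convexHull ℝ _) (fun _ => isState_of_mem_separableStates)
    subset_rfl hN (S := robustnessSet N)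
    (fun s => by simp only [robustnessSet, Set.mem_ofPred_eq, isEB_iff])
  obtain ⟨hRG, G₂, hG₂0, hG₂1, -, hG₂N⟩ := exists_optimal_witness (T := {X | IsState X})
    isCompact_setOf_isState convex_setOf_isState (fun _ h => h)
    (fun _ => isState_of_mem_separableStates) hN (S := genRobustnessSet N)
    (fun s => by simp only [genRobustnessSet, Set.mem_ofPred_eq, isChannel_iff])
  have hle : ∀ (G : Game A B) M, IsEB M → payoff M G ≤ bestEBPayoff G := fun G M hM =>
    (isGreatest_bestEBPayoff G).2 ⟨M, hM, rfl⟩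
  refine ⟨hR, hRG, isGreatest_bestEBPayoff, fun G h0 hbest => ?_, ⟨⟨G₁, ?_, ?_, ?_⟩, ?_⟩,
    ⟨⟨G₂, ?_, hG₂1, hG₂N.symm⟩, ?_⟩, fun G => ⟨G.isHermitian_witness, fun M hM => ?_⟩,
    fun W hW => exists_game_witness_eq hW⟩
  -- All EB payoffs vanish, and `N` is an affine combination of two EB channels.
  · have hz : ∀ M, IsEB M → payoff M G = 0 := fun M hM =>
      le_antisymm (hbest ▸ hle G M hM) (h0 M hM)
    obtain ⟨hs, M, hM, hE⟩ := hR.1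
    rw [payoff_mixture N M G hs, hz _ hM, hz _ hE]
    ring
  · exact fun M hM => hG₁0 M ((isEB_iff M).1 hM)
  · exact zero_lt_one.trans_le (hE₁1 ▸ hle G₁ E₁ hE₁)
  · have : bestEBPayoff G₁ = 1 := by
      obtain ⟨M, hM, h⟩ := (isGreatest_bestEBPayoff G₁).1
      exact le_antisymm (h ▸ hG₁1 M hM) (hE₁1 ▸ hle G₁ E₁ hE₁)
    rw [this, div_one, hG₁N]
    rfl
  · rintro _ ⟨G, h0, hpos, rfl⟩
    obtain ⟨hs, M, hM, hE⟩ := hR.1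
    rw [div_le_iff₀ hpos, payoff_mixture N M G hs]
    have h1 := mul_le_mul_of_nonneg_left (hle G _ hE)
      (by positivity : 0 ≤ 1 + sInf (robustnessSet N))
    have h2 := mul_nonneg hs (h0 M hM)
    change _ ≤ (1 + sInf (robustnessSet N)) * _
    linarith
  · exact fun M hM => hG₂0 M ((isChannel_iff M).1 hM)
  · rintro _ ⟨G, h0, h1, rfl⟩
    obtain ⟨hs, M, hM, hE⟩ := hRG.1
    rw [payoff_mixture N M G hs]
    have h2 := mul_le_mul_of_nonneg_left (h1 _ hE)
      (by positivity : 0 ≤ 1 + sInf (genRobustnessSet N))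
    have h3 := mul_nonneg hs (h0 M hM)
    change _ ≤ 1 + sInf (genRobustnessSet N)
    linarith
  · rw [payoff_eq]
    exact trace_mul_eq_ofReal_re ((isChannel_iff M).1 hM).1.1.isHermitian G.isHermitian_witness
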